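/- A finite set $X$ of unit vectors in $\mathbb{R}^r$ is \emph{equiangular with angle} $\alpha\in[0,1)$ if $\langle x,y\rangle\in\{-\alpha,\alpha\}$ for all distinct $x,y\in X$. Its \emph{base size} $K(X)$ is the largest $k$ for which there are $p_1,\dots,p_k\in X$ whose Gram matrix becomes $(1+\alpha)I-\alpha J$ ($J$ the all-one matrix) after replacing some of the $p_i$ by $-p_i$ and reordering. For $K=K(X)$, a \emph{$K$-base} of $X$ is a family $p_1,\dots,p_K$ with $p_i\in X\cup(-X)$ and Gram matrix exactly $(1+\alpha)I-\alpha J$. Let $\alpha>0$ and fix a $K$-base $P=\{p_1,\dots,p_K\}$. For $x\in X$ with $\pm x\notin P$ let $\varepsilon(x)\in\{1,-1\}^K$ be given by $(\langle x,p_1\rangle,\dots,\langle x,p_K\rangle)=\alpha\,\varepsilon(x)$. Replace $x$ by $-x$ if $\varepsilon(x)$ has more positive entries than $\varepsilon(-x)$, or if it has equally many and $\langle x,p_K\rangle=\alpha$. The resulting vectors are partitioned into \emph{pillars}, two vectors being in the same pillar if and only if they have the same $\varepsilon$. A pillar is nonempty by definition, and it is a \emph{$(K,n)$ pillar} if its $\varepsilon$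 has exactly $n$ positive entries. \textbf{Theorem.} Let $X$ be an equiangular set with angle $\frac15$ and base size $K(X)=3$ in $\mathbb{R}^r$. (a) With respect to any $3$-base of $X$: if $S$ and $T$ are two distinct $(3,1)$ pillars and $|S|\ge 4$, then $|T|\le 54$. (b) $|X|\le\max\{165,\,r+6\}$. (c) Consequently $X$ satisfies the upper bound of the Lemmens--Seidel conjecture, even strictly: $|X|<276$ if $23\le r\le 185$, and $|X|<\lfloor\frac12(r-5)\rfloor+r+1$ if $r\ge 185$. -/

import Mathlib

/-- A finite set `X` of unit vectors in `ℝ^r` is equiangular with angle `α ∈ [0, 1)` if any two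
distinct vectors of `X` have inner product `-α` or `α`. -/
def IsEquiangular {r : ℕ} (X : Finset (EuclideanSpace ℝ (Fin r))) (α : ℝ) : Prop :=
  0 ≤ α ∧ α < 1 ∧ (∀ x ∈ X, ‖x‖ = 1) ∧
    ∀ x ∈ X, ∀ y ∈ X, x ≠ y → inner ℝ x y = -α ∨ inner ℝ x y = α

/-- Switching equivalence `G ≃ H` of square matrices: `(C B)ᵀ G (C B) = H` for some diagonal
`(1,-1)`-matrix `B` and some permutation matrix `C`. -/
def SwitchingEquivalent {k : ℕ} (G H : Matrix (Fin k) (Fin k) ℝ) : Prop :=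
  ∃ (b : Fin k → ℝ) (σ : Equiv.Perm (Fin k)), (∀ i, b i = 1 ∨ b i = -1) ∧
    (σ.permMatrix ℝ * Matrix.diagonal b).transpose * G * (σ.permMatrix ℝ * Matrix.diagonal b) = H

/-- The matrix `(1 + α) I - α J` of size `k × k`. -/
def cliqueGram (k : ℕ) (α : ℝ) : Matrix (Fin k) (Fin k) ℝ :=
  (1 + α) • (1 : Matrix (Fin k) (Fin k) ℝ) - α • Matrix.of (fun _ _ => (1 : ℝ))

/-- `K` is the base size of `X`: the maximum of all `k` such that some `p_1, …, p_k` in `X` have a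
Gram matrix that is switching equivalent to `(1 + α) I - α J`. -/
def HasBaseSize {r : ℕ} (X : Finset (EuclideanSpace ℝ (Fin r))) (α : ℝ) (K : ℕ) : Prop :=
  IsGreatest {k : ℕ | ∃ p : Fin k → EuclideanSpace ℝ (Fin r), (∀ i, p i ∈ X) ∧
    SwitchingEquivalent (Matrix.gram ℝ p) (cliqueGram k α)} K

open Classical in
/-- `Y` arises from `X` by replacing some of its vectors by their negatives. -/
def InSwitchingClass {r : ℕ} (X Y : Finset (EuclideanSpace ℝ (Fin r))) : Prop :=
  ∃ s : EuclideanSpace ℝ (Fin r) → ℝ, (∀ x, s x = 1 ∨ s x = -1) ∧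
    Y = X.image (fun x => s x • x)

/-- `p_1, …, p_K` is a `K`-base of `X`, where `K` is the base size of `X`. -/
def IsKBase {r K : ℕ} (X : Finset (EuclideanSpace ℝ (Fin r))) (α : ℝ)
    (p : Fin K → EuclideanSpace ℝ (Fin r)) : Prop :=
  HasBaseSize X α K ∧ (∃ Y, InSwitchingClass X Y ∧ ∀ i, p i ∈ Y) ∧
    Matrix.gram ℝ p = cliqueGram K α

/-- The vector `ε(x)` with `(⟨x, p_1⟩, …, ⟨x, p_K⟩) = α ε(x)`, for `α ≠ 0`. -/
noncomputable def epsVec {r K : ℕ} (α : ℝ) (p : Fin K → EuclideanSpace ℝ (Fin r))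
    (x : EuclideanSpace ℝ (Fin r)) : Fin K → ℝ :=
  fun i => inner ℝ x (p i) / α

open Classical in
/-- The number `Σ(e)` of positive entries of `e`. -/
noncomputable def posCount {K : ℕ} (e : Fin K → ℝ) : ℕ :=
  (Finset.univ.filter (fun i => 0 < e i)).card

open Classical in
/-- The sign choice of the pillar decomposition: `x` is replaced by `-x` if `ε(x)` has more positive
entries than `ε(-x)`, or equally many and `⟨x, p_K⟩ = α` (the index `i` with `i + 1 = K` is the last
one); otherwise `x` stays. -/
noncomputable def normalizeSign {r K : ℕ} (α : ℝ) (p : Fin K → EuclideanSpace ℝ (Fin r))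
    (x : EuclideanSpace ℝ (Fin r)) : EuclideanSpace ℝ (Fin r) :=
  if posCount (epsVec α p (-x)) < posCount (epsVec α p x) ∨
      (posCount (epsVec α p (-x)) = posCount (epsVec α p x) ∧
        ∃ i : Fin K, (i : ℕ) + 1 = K ∧ inner ℝ x (p i) = α)
  then -x else x

open Classical in
/-- `X ∖ P` with the signs chosen as in the pillar decomposition. The signs of the vectors of `X`
that span the lines of `P` are those of `P`, so both `p_i` and `-p_i` are removed. -/
noncomputable def outsideBase {r K : ℕ} (X : Finset (EuclideanSpace ℝ (Fin r))) (α : ℝ)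
    (p : Fin K → EuclideanSpace ℝ (Fin r)) : Finset (EuclideanSpace ℝ (Fin r)) :=
  (X.filter (fun x => ∀ i, x ≠ p i ∧ x ≠ -p i)).image (normalizeSign α p)

open Classical in
/-- The pillar containing `x`: all `x'` outside the base with `ε(x') = ε(x)`. -/
noncomputable def pillar {r K : ℕ} (X : Finset (EuclideanSpace ℝ (Fin r))) (α : ℝ)
    (p : Fin K → EuclideanSpace ℝ (Fin r)) (x : EuclideanSpace ℝ (Fin r)) :
    Finset (EuclideanSpace ℝ (Fin r)) :=
  (outsideBase X α p).filter (fun x' => epsVec α p x' = epsVec α p x)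

/-- `S` is a (nonempty) `(K, n)` pillar of `X` with respect to the base `p_1, …, p_K`. -/
def IsPillar {r K : ℕ} (X : Finset (EuclideanSpace ℝ (Fin r))) (α : ℝ)
    (p : Fin K → EuclideanSpace ℝ (Fin r)) (n : ℕ)
    (S : Finset (EuclideanSpace ℝ (Fin r))) : Prop :=
  ∃ x ∈ outsideBase X α p, posCount (epsVec α p x) = n ∧ S = pillar X α p x

/-! ### Gram matrices `a I + b J` and Bessel bounds -/

section Gram

variable {V : Type*} [NormedAddCommGroup V] [InnerProductSpace ℝ V]

/-! Fix three lines with mutual inner products -1/5. By base size 3 no four lines can be signed so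
that all inner products are -1/5. Hence, after the sign choice, every other vector has exactly one
positive product with the base, so there are at most three pillars, one per peak. Two vectors of one
pillar have inner product 1/5, since otherwise they would form such a quadruple with the two base
vectors away from the peak.

Projecting away from the base turns each pillar into a family with Gram matrix 4/5 I + 4/45 J. This
is positive definite, so a pillar has at most r - 3 vectors. Between different pillars the projected
inner products are 2/9 or -8/45.

Now take four vectors of S. Each vector of T determines the subset N of those four on which its
product is positive. The forbidden quadruple makes these subsets a chain, so each size k occurs with
only one N. Bessel's inequality against the four vectors, applied to the sum of all vectors of T
with the same N, bounds each class (`card_bound_of_pattern`). The bound 39 for the empty pattern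
drops to 22 once a pattern of size at least 2 occurs (`card_bound_of_two_patterns`), which gives |T|
≤ 54.

For the total: if two pillars have at least 4 vectors, all three have at most 54; otherwise at most
one pillar exceeds 3 and dimension bounds it. -/

open Classical in
/-- The quadratic form of a family with Gram matrix `a I + b J`. -/
theorem inner_sum_smul_of_gram {ι : Type*} (U : Finset ι) (f : ι → V) (a b : ℝ)
    (h : ∀ x ∈ U, ∀ y ∈ U, inner ℝ (f x) (f y) = if x = y then a + b else b) (c : ι → ℝ) :
    inner ℝ (∑ x ∈ U, c x • f x) (∑ x ∈ U, c x • f x) =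
      a * ∑ x ∈ U, c x ^ 2 + b * (∑ x ∈ U, c x) ^ 2 := by
  have hx : ∀ x ∈ U, inner ℝ (c x • f x) (∑ y ∈ U, c y • f y) =
      a * c x ^ 2 + b * (c x * ∑ y ∈ U, c y) := by
    intro x hxU
    rw [inner_sum]
    have : ∀ y ∈ U, inner ℝ (c x • f x) (c y • f y) =
        (if x = y then a * (c x * c y) else 0) + b * (c x * c y) := by
      intro y hyU
      rw [real_inner_smul_left, real_inner_smul_right, h x hxU y hyU]
      split_ifs <;> ring
    rw [Finset.sum_congr rfl this, Finset.sum_add_distrib, Finset.sum_ite_eq, if_pos hxU,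
      ← Finset.mul_sum, ← Finset.mul_sum]
    ring
  rw [sum_inner, Finset.sum_congr rfl hx, Finset.sum_add_distrib, ← Finset.mul_sum,
    ← Finset.mul_sum, ← Finset.sum_mul]
  ring

/-- Bessel's inequality for four vectors with Gram matrix `4/5 I + 4/45 J`. -/
theorem bessel_four (s : Fin 4 → V)
    (hs : ∀ i j, inner ℝ (s i) (s j) = if i = j then (4 / 5 + 4 / 45 : ℝ) else 4 / 45) (z : V) :
    ∑ i, inner ℝ (s i) z ^ 2 - (∑ i, inner ℝ (s i) z) ^ 2 / 13 ≤ 4 / 5 * inner ℝ z z := by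
  set g : Fin 4 → ℝ := fun i => inner ℝ (s i) z with hg
  -- The coefficients of the orthogonal projection of `z` to the span of `s`: the inverse of 4/5 I +
  -- 4/45 J is 5/4 (I - J/13).
  set w : Fin 4 → ℝ := fun i => 5 / 4 * (g i - (∑ j, g j) / 13) with hw
  have h0 : 0 ≤ inner ℝ (z - ∑ i, w i • s i) (z - ∑ i, w i • s i) := real_inner_self_nonneg
  have h1 : inner ℝ (∑ i, w i • s i) z = ∑ i, w i * g i := by
    simp only [sum_inner, real_inner_smul_left, hg]
  have h2 := inner_sum_smul_of_gram Finset.univ s (4 / 5) (4 / 45)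
    (fun x _ y _ => by convert hs x y) w
  rw [inner_sub_left, inner_sub_right, inner_sub_right,
    real_inner_comm (∑ i, w i • s i) z, h1, h2] at h0
  change ∑ i, g i ^ 2 - (∑ i, g i) ^ 2 / 13 ≤ _
  simp only [hw, Fin.sum_univ_four] at h0 ⊢
  linarith

theorem sum_ite_mem_four (N : Finset (Fin 4)) (a b : ℝ) :
    ∑ i, (if i ∈ N then a else b) = N.card * a + (4 - N.card) * b := by
  have h : ∀ i, (if i ∈ N then a else b) = b + (if i ∈ N then a - b else 0) := by
    intro i
    split_ifs <;> ring
  simp only [h, Finset.sum_add_distrib, Finset.sum_ite_mem, Finset.univ_inter, Finset.sum_const,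
    Finset.card_univ, Fintype.card_fin, nsmul_eq_mul]
  push_cast
  ring

open Classical in
/-- Vectors with Gram matrix `4/5 I + 4/45 J` whose inner products with `s` have the same pattern
are few. -/
theorem card_bound_of_pattern {ι : Type*} (s : Fin 4 → V)
    (hs : ∀ i j, inner ℝ (s i) (s j) = if i = j then (4 / 5 + 4 / 45 : ℝ) else 4 / 45)
    (f : ι → V) (U : Finset ι)
    (hU : ∀ x ∈ U, ∀ y ∈ U, inner ℝ (f x) (f y) = if x = y then (4 / 5 + 4 / 45 : ℝ) else 4 / 45)
    (N : Finset (Fin 4))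
    (hN : ∀ x ∈ U, ∀ i, inner ℝ (s i) (f x) = if i ∈ N then (2 / 9 : ℝ) else -8 / 45) :
    (U.card : ℝ) * ((N.card * (2 / 9) ^ 2 + (4 - N.card) * (8 / 45) ^ 2) -
      (N.card * (2 / 9) - (4 - N.card) * (8 / 45)) ^ 2 / 13 - 16 / 225 : ℝ) ≤ 16 / 25 := by
  rcases U.eq_empty_or_nonempty with rfl | hne
  · norm_num
  have hpos : (0 : ℝ) < U.card := by exact_mod_cast hne.card_pos
  -- Both sides are quadratic in |U|; the coefficient of |U|² left after subtracting ‖z‖² is what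
  -- makes the bound finite when positive.
  have hB := bessel_four s hs (∑ x ∈ U, f x)
  have hz := inner_sum_smul_of_gram U f _ _ hU (fun _ => 1)
  have hg : ∀ i, inner ℝ (s i) (∑ x ∈ U, f x) =
      if i ∈ N then (U.card : ℝ) * (2 / 9) else U.card * (-8 / 45) := by
    intro i
    rw [inner_sum, Finset.sum_congr rfl (fun x hx => hN x hx i), Finset.sum_const, nsmul_eq_mul]
    split_ifs <;> rfl
  simp only [one_smul, one_pow, Finset.sum_const, nsmul_eq_mul, mul_one] at hz
  simp only [hg, hz, ite_pow, sum_ite_mem_four] at hB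
  have : (U.card : ℝ) * (U.card * ((N.card * (2 / 9) ^ 2 + (4 - N.card) * (8 / 45) ^ 2) -
      (N.card * (2 / 9) - (4 - N.card) * (8 / 45)) ^ 2 / 13 - 16 / 225 : ℝ)) ≤
      U.card * (16 / 25) := by
    linarith
  exact le_of_mul_le_mul_left this hpos

open Classical in
/-- Vectors of the all-negative pattern, in the presence of a vector of another pattern. -/
theorem card_bound_of_two_patterns {ι : Type*} (s : Fin 4 → V)
    (hs : ∀ i j, inner ℝ (s i) (s j) = if i = j then (4 / 5 + 4 / 45 : ℝ) else 4 / 45)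
    (f : ι → V) (U : Finset ι) (u : ι) (hu : u ∉ U)
    (hU : ∀ x ∈ insert u U, ∀ y ∈ insert u U,
      inner ℝ (f x) (f y) = if x = y then (4 / 5 + 4 / 45 : ℝ) else 4 / 45)
    (N : Finset (Fin 4)) (h0 : ∀ x ∈ U, ∀ i, inner ℝ (s i) (f x) = (-8 / 45 : ℝ))
    (hN : ∀ i, inner ℝ (s i) (f u) = if i ∈ N then (2 / 9 : ℝ) else -8 / 45)
    (hcard : 2 ≤ N.card) : U.card ≤ 22 := by
  rcases U.eq_empty_or_nonempty with rfl | hne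
  · norm_num
  have hpos : (0 : ℝ) < U.card := by exact_mod_cast hne.card_pos
  set n : ℝ := (U.card : ℝ) with hn
  have hne' : ∀ x ∈ U, x ≠ u := fun x hx h => hu (h ▸ hx)
  -- Adding a multiple of `f u` to the sum sharpens Bessel. The weight -3/20 is nearly optimal for
  -- |N| = 2, the weakest case, where it gives about 22.3; it also suffices for |N| = 3 and 4.
  have hz := inner_sum_smul_of_gram (insert u U) f _ _ hU
    (fun x => if x = u then -(3 / 20) * n else 1)
  have hsum : ∀ g : ι → V, ∑ x ∈ U, (if x = u then -(3 / 20) * n else 1) • g x = ∑ x ∈ U, g x := by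
    intro g
    refine Finset.sum_congr rfl fun x hx => ?_
    rw [if_neg (hne' x hx), one_smul]
  have hsum1 : ∑ x ∈ U, (if x = u then -(3 / 20) * n else 1) = n := by
    rw [Finset.sum_congr rfl fun x hx => if_neg (hne' x hx)]
    simp [hn]
  have hsum2 : ∑ x ∈ U, (if x = u then -(3 / 20) * n else 1) ^ 2 = n := by
    rw [Finset.sum_congr rfl fun x hx => by rw [if_neg (hne' x hx)]]
    simp [hn]
  simp only [Finset.sum_insert hu, if_true, hsum, hsum1, hsum2] at hz
  have hB := bessel_four s hs (((-(3 / 20) * n) • f u) + ∑ x ∈ U, f x)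
  have hg : ∀ i, inner ℝ (s i) (((-(3 / 20) * n) • f u) + ∑ x ∈ U, f x) =
      if i ∈ N then n * (-8 / 45 - 3 / 20 * (2 / 9)) else n * (-8 / 45 + 3 / 20 * (8 / 45)) := by
    intro i
    rw [inner_add_right, real_inner_smul_right, inner_sum,
      Finset.sum_congr rfl (fun x hx => h0 x hx i), Finset.sum_const, nsmul_eq_mul, hN]
    split_ifs <;> ring
  simp only [hg, hz, ite_pow, sum_ite_mem_four] at hB
  have hle : N.card ≤ 4 := by simpa using N.card_le_univ
  have key : n * n ≤ n * 22.5 := by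
    have hk : N.card = 2 ∨ N.card = 3 ∨ N.card = 4 := by omega
    rcases hk with hk | hk | hk <;> rw [hk] at hB <;> push_cast at hB <;> nlinarith
  have h22 : n ≤ 22.5 := le_of_mul_le_mul_left key hpos
  have : (U.card : ℝ) < 23 := by linarith
  have : U.card < 23 := by exact_mod_cast this
  omega

open Classical in
/-- Vectors with Gram matrix `4/5 I + 4/45 J` whose patterns with respect to `s` form a chain. -/
theorem card_le_of_nested {ι : Type*} (s : Fin 4 → V)
    (hs : ∀ i j, inner ℝ (s i) (s j) = if i = j then (4 / 5 + 4 / 45 : ℝ) else 4 / 45)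
    (f : ι → V) (T : Finset ι)
    (hT : ∀ x ∈ T, ∀ y ∈ T, inner ℝ (f x) (f y) = if x = y then (4 / 5 + 4 / 45 : ℝ) else 4 / 45)
    (N : ι → Finset (Fin 4))
    (hN : ∀ x ∈ T, ∀ i, inner ℝ (s i) (f x) = if i ∈ N x then (2 / 9 : ℝ) else -8 / 45)
    (hnest : ∀ x ∈ T, ∀ y ∈ T, N x ⊆ N y ∨ N y ⊆ N x) : T.card ≤ 54 := by
  set C : ℕ → Finset ι := fun k => T.filter (fun x => (N x).card = k) with hC
  have hsum : T.card = ∑ k ∈ Finset.range 5, (C k).card :=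
    Finset.card_eq_sum_card_fiberwise fun x _ => by
      have : (N x).card ≤ 4 := by simpa using (N x).card_le_univ
      simpa using Nat.lt_succ_of_le this
  have hmem : ∀ {k x}, x ∈ C k → x ∈ T ∧ (N x).card = k := fun h => by simpa [hC] using h
  -- In a chain, sets of equal size coincide.
  have hsame : ∀ {k x y}, x ∈ C k → y ∈ C k → N y = N x := by
    intro k x y hx hy
    obtain ⟨hx, hxk⟩ := hmem hx
    obtain ⟨hy, hyk⟩ := hmem hy
    rcases hnest x hx y hy with h | h
    · exact (Finset.eq_of_subset_of_card_le h (by omega)).symm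
    · exact Finset.eq_of_subset_of_card_le h (by omega)
  have hb : ∀ k : ℕ, (C k).card = 0 ∨
      ((C k).card : ℝ) * ((k * (2 / 9) ^ 2 + (4 - k) * (8 / 45) ^ 2) -
      (k * (2 / 9) - (4 - k) * (8 / 45)) ^ 2 / 13 - 16 / 225 : ℝ) ≤ 16 / 25 := by
    intro k
    rcases (C k).eq_empty_or_nonempty with h | ⟨x, hx⟩
    · left; rw [h, Finset.card_empty]
    · right
      have := card_bound_of_pattern s hs f (C k)
        (fun y hy z hz => hT y (hmem hy).1 z (hmem hz).1) (N x)
        (fun y hy i => by rw [hN y (hmem hy).1 i, hsame hx hy])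
      rwa [(hmem hx).2] at this
  have bound : ∀ k m : ℕ, (∀ a : ℝ, a *
      ((k * (2 / 9) ^ 2 + (4 - k) * (8 / 45) ^ 2) -
      (k * (2 / 9) - (4 - k) * (8 / 45)) ^ 2 / 13 - 16 / 225 : ℝ) ≤ 16 / 25 → a < (m + 1 : ℕ)) →
      (C k).card ≤ m := by
    intro k m h
    rcases hb k with h' | h'
    · omega
    · have := h _ h'
      have : (C k).card < m + 1 := by exact_mod_cast this
      omega
  -- The real bounds are exactly 39 for k = 0, about 9.75 for k = 1, 4 and about 7.09 for k = 2, 3.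
  have b0 : (C 0).card ≤ 39 := bound 0 39 fun a ha => by push_cast at ha ⊢; linarith
  have b1 : (C 1).card ≤ 9 := bound 1 9 fun a ha => by push_cast at ha ⊢; linarith
  have b2 : (C 2).card ≤ 7 := bound 2 7 fun a ha => by push_cast at ha ⊢; linarith
  have b3 : (C 3).card ≤ 7 := bound 3 7 fun a ha => by push_cast at ha ⊢; linarith
  have b4 : (C 4).card ≤ 9 := bound 4 9 fun a ha => by push_cast at ha ⊢; linarith
  have b22 : ∀ k, 2 ≤ k → (C k).Nonempty → (C 0).card ≤ 22 := by
    rintro k hk ⟨u, hu⟩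
    obtain ⟨huT, huk⟩ := hmem hu
    refine card_bound_of_two_patterns s hs f (C 0) u (fun h => ?_) ?_ (N u) ?_ (hN u huT)
      (by omega)
    · have := (hmem h).2
      omega
    · have hins : ∀ x ∈ insert u (C 0), x ∈ T := by
        intro x hx
        rcases Finset.mem_insert.1 hx with rfl | hx
        · exact huT
        · exact (hmem hx).1
      exact fun x hx y hy => hT x (hins x hx) y (hins y hy)
    · intro x hx i
      rw [hN x (hmem hx).1 i, Finset.card_eq_zero.1 (hmem hx).2, if_neg (Finset.notMem_empty i)]
  simp only [Finset.sum_range_succ, Finset.sum_range_zero] at hsum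
  -- Either 22 + 9 + 7 + 7 + 9 = 54, or only patterns of size 0 and 1 occur and 39 + 9 = 48.
  by_cases h : (C 0).card ≤ 22
  · omega
  · have e : ∀ k, 2 ≤ k → (C k).card = 0 := fun k hk => by
      by_contra hne
      exact h (b22 k hk (Finset.card_pos.1 (Nat.pos_of_ne_zero hne)))
    have := e 2 le_rfl
    have := e 3 (by omega)
    have := e 4 (by omega)
    omega

end Gram

/-! ### Lines of X and the forbidden quadruple -/

section Equiangular

variable {r : ℕ} {X : Finset (EuclideanSpace ℝ (Fin r))}

/-- `x` or `-x` lies in `X`. -/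
def SpansLineOf (X : Finset (EuclideanSpace ℝ (Fin r))) (x : EuclideanSpace ℝ (Fin r)) : Prop :=
  x ∈ X ∨ -x ∈ X

theorem SpansLineOf.norm_eq (hX : IsEquiangular X (1 / 5)) {x : EuclideanSpace ℝ (Fin r)}
    (hx : SpansLineOf X x) : ‖x‖ = 1 := by
  rcases hx with h | h
  · exact hX.2.2.1 x h
  · rw [← norm_neg]; exact hX.2.2.1 _ h

theorem SpansLineOf.inner_self (hX : IsEquiangular X (1 / 5)) {x : EuclideanSpace ℝ (Fin r)}
    (hx : SpansLineOf X x) : inner ℝ x x = (1 : ℝ) := by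
  rw [real_inner_self_eq_norm_sq, hx.norm_eq hX, one_pow]

theorem SpansLineOf.inner_eq (hX : IsEquiangular X (1 / 5)) {x y : EuclideanSpace ℝ (Fin r)}
    (hx : SpansLineOf X x) (hy : SpansLineOf X y) (h1 : x ≠ y) (h2 : x ≠ -y) :
    inner ℝ x y = (-(1 / 5) : ℝ) ∨ inner ℝ x y = (1 / 5 : ℝ) := by
  have h3 : -x ≠ y := fun h => h2 (by rw [← h, neg_neg])
  have h4 : -x ≠ -y := fun h => h1 (neg_injective h)
  rcases hx with hx | hx <;> rcases hy with hy | hy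
  · exact hX.2.2.2 x hx y hy h1
  · have := hX.2.2.2 x hx _ hy h2
    rw [inner_neg_right] at this
    rcases this with h | h
    · right; linarith
    · left; linarith
  · have := hX.2.2.2 _ hx y hy h3
    rw [inner_neg_left] at this
    rcases this with h | h
    · right; linarith
    · left; linarith
  · have := hX.2.2.2 _ hx _ hy h4
    rwa [inner_neg_neg] at this

theorem not_neg_mem (hX : IsEquiangular X (1 / 5)) {x : EuclideanSpace ℝ (Fin r)} (hx : x ∈ X) :
    -x ∉ X := by
  intro h
  have h1 := SpansLineOf.inner_self hX (Or.inl hx)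
  have hne : x ≠ -x := by
    intro h'
    have : inner ℝ x (-x) = (1 : ℝ) := by rw [← h']; exact h1
    rw [inner_neg_right, h1] at this
    norm_num at this
  have h2 := hX.2.2.2 x hx _ h hne
  rw [inner_neg_right, h1] at h2
  norm_num at h2

/-- Base size three rules out four lines with mutual inner products `-1/5`. -/
theorem no_four_clique (hK : HasBaseSize X (1 / 5) 3) (q : Fin 4 → EuclideanSpace ℝ (Fin r))
    (hq : ∀ i, SpansLineOf X (q i))
    (hG : ∀ i j, inner ℝ (q i) (q j) = if i = j then (1 : ℝ) else -(1 / 5)) : False := by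
  have hc : ∀ i, ∃ c : ℝ, (c = 1 ∨ c = -1) ∧ c • q i ∈ X := by
    intro i
    rcases hq i with h | h
    · exact ⟨1, Or.inl rfl, by rwa [one_smul]⟩
    · exact ⟨-1, Or.inr rfl, by rwa [neg_one_smul]⟩
  choose c hc hcX using hc
  have hcc : ∀ i, c i * c i = 1 := fun i => by rcases hc i with h | h <;> rw [h] <;> norm_num
  have : 4 ≤ 3 := hK.2 ⟨fun i => c i • q i, hcX, c, 1, hc, by
    ext i j
    simp only [Matrix.permMatrix_one, one_mul,
      Matrix.diagonal_transpose, Matrix.mul_diagonal, Matrix.diagonal_mul, Matrix.gram_apply,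
      real_inner_smul_left, real_inner_smul_right, hG, cliqueGram, Matrix.sub_apply,
      Matrix.smul_apply, Matrix.one_apply, Matrix.of_apply, smul_eq_mul]
    have hi := hcc i
    have hj := hcc j
    split_ifs with h
    · linear_combination hi * c j * c j + hj
    · linear_combination (-(1 / 5) : ℝ) * (hi * c j * c j + hj)⟩
  omega

theorem no_four_clique' (hX : IsEquiangular X (1 / 5)) (hK : HasBaseSize X (1 / 5) 3)
    {a b c d : EuclideanSpace ℝ (Fin r)}
    (ha : SpansLineOf X a) (hb : SpansLineOf X b) (hc : SpansLineOf X c) (hd : SpansLineOf X d)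
    (hab : inner ℝ a b = (-(1 / 5) : ℝ)) (hac : inner ℝ a c = (-(1 / 5) : ℝ))
    (had : inner ℝ a d = (-(1 / 5) : ℝ)) (hbc : inner ℝ b c = (-(1 / 5) : ℝ))
    (hbd : inner ℝ b d = (-(1 / 5) : ℝ)) (hcd : inner ℝ c d = (-(1 / 5) : ℝ)) : False := by
  refine no_four_clique hK ![a, b, c, d] ?_ ?_
  · intro i
    fin_cases i
    exacts [ha, hb, hc, hd]
  · have ha' := ha.norm_eq hX
    have hb' := hb.norm_eq hX
    have hc' := hc.norm_eq hX
    have hd' := hd.norm_eq hX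
    have hba := real_inner_comm a b
    have hca := real_inner_comm a c
    have hda := real_inner_comm a d
    have hcb := real_inner_comm b c
    have hdb := real_inner_comm b d
    have hdc := real_inner_comm c d
    intro i j
    fin_cases i <;> fin_cases j <;> simp [ha', hb', hc', hd'] <;> linarith

theorem SpansLineOf.neg {x : EuclideanSpace ℝ (Fin r)} (hx : SpansLineOf X x) :
    SpansLineOf X (-x) := by
  rcases hx with h | h
  · right; rwa [neg_neg]
  · exact Or.inl h

/-- Three lines of `X` with mutual inner products `-1/5`. -/
structure IsTriangle (X : Finset (EuclideanSpace ℝ (Fin r)))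
    (p : Fin 3 → EuclideanSpace ℝ (Fin r)) : Prop where
  spans : ∀ i, SpansLineOf X (p i)
  gram : ∀ i j, inner ℝ (p i) (p j) = if i = j then (1 : ℝ) else -(1 / 5)

/-! ### Pillars and their projections away from the base -/

variable {p : Fin 3 → EuclideanSpace ℝ (Fin r)}

/-- The sign pattern of the pillar with positive entry `i`. -/
def HasPeak (p : Fin 3 → EuclideanSpace ℝ (Fin r)) (i : Fin 3) (x : EuclideanSpace ℝ (Fin r)) :
    Prop :=
  ∀ j, inner ℝ x (p j) = if j = i then (1 / 5 : ℝ) else -(1 / 5)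

/-- With three base vectors and two peaks, some base vector is negative for both. -/
theorem HasPeak.ne_neg {i j : Fin 3} {x y : EuclideanSpace ℝ (Fin r)} (hx : HasPeak p i x)
    (hy : HasPeak p j y) : x ≠ -y := by
  intro h
  obtain ⟨k, hki, hkj⟩ : ∃ k : Fin 3, k ≠ i ∧ k ≠ j := by
    clear hx hy
    revert i j
    decide
  have h1 := hx k
  have h2 := hy k
  rw [h, inner_neg_left, h2, if_neg hki, if_neg hkj] at h1
  norm_num at h1

theorem HasPeak.ne {i j : Fin 3} (hij : i ≠ j) {x y : EuclideanSpace ℝ (Fin r)}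
    (hx : HasPeak p i x) (hy : HasPeak p j y) : x ≠ y := by
  intro h
  have h1 := hx i
  have h2 := hy i
  rw [h, h2, if_neg hij, if_pos rfl] at h1
  norm_num at h1

/-- Within a pillar all inner products are `1/5`. -/
theorem HasPeak.inner_eq (hX : IsEquiangular X (1 / 5)) (hK : HasBaseSize X (1 / 5) 3)
    (hp : IsTriangle X p) {i : Fin 3} {x y : EuclideanSpace ℝ (Fin r)} (hxX : SpansLineOf X x)
    (hyX : SpansLineOf X y) (hx : HasPeak p i x) (hy : HasPeak p i y) (hxy : x ≠ y) :
    inner ℝ x y = (1 / 5 : ℝ) := by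
  refine (hxX.inner_eq hX hyX hxy (hx.ne_neg hy)).resolve_left fun h => ?_
  obtain ⟨j, k, hj, hk, hjk⟩ : ∃ j k : Fin 3, j ≠ i ∧ k ≠ i ∧ j ≠ k := by
    clear hx hy
    revert i
    decide
  refine no_four_clique' hX hK hxX hyX (hp.spans j) (hp.spans k) h ?_ ?_ ?_ ?_ ?_
  · rw [hx j, if_neg hj]
  · rw [hx k, if_neg hk]
  · rw [hy j, if_neg hj]
  · rw [hy k, if_neg hk]
  · rw [hp.gram j k, if_neg hjk]

theorem HasPeak.inner_eq_or (hX : IsEquiangular X (1 / 5))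
    {i j : Fin 3} (hij : i ≠ j) {x y : EuclideanSpace ℝ (Fin r)} (hxX : SpansLineOf X x)
    (hyX : SpansLineOf X y) (hx : HasPeak p i x) (hy : HasPeak p j y) :
    inner ℝ x y = (-(1 / 5) : ℝ) ∨ inner ℝ x y = (1 / 5 : ℝ) :=
  hxX.inner_eq hX hyX (hx.ne hij hy) (hx.ne_neg hy)

/-- The component of a vector with peak `i` that is orthogonal to the base. -/
noncomputable def pillarResidual (p : Fin 3 → EuclideanSpace ℝ (Fin r)) (i : Fin 3)
    (x : EuclideanSpace ℝ (Fin r)) : EuclideanSpace ℝ (Fin r) :=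
  x - (1 / 3 : ℝ) • p i + (2 / 9 : ℝ) • (p 0 + p 1 + p 2)

/-- The coefficients in `pillarResidual` come from the inverse 5/6 (I + J/3) of the base Gram
matrix, applied to the products of `x` with the base. -/
theorem inner_pillarResidual_base (hp : IsTriangle X p) {i : Fin 3} {x : EuclideanSpace ℝ (Fin r)}
    (hx : HasPeak p i x) (j : Fin 3) : inner ℝ (pillarResidual p i x) (p j) = (0 : ℝ) := by
  simp only [pillarResidual, inner_add_left, inner_sub_left, real_inner_smul_left, hp.gram, hx j]
  fin_cases i <;> fin_cases j <;> norm_num [Fin.ext_iff]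

theorem inner_pillarResidual (hp : IsTriangle X p) {i j : Fin 3} {x y : EuclideanSpace ℝ (Fin r)}
    (hx : HasPeak p i x) (hy : HasPeak p j y) :
    inner ℝ (pillarResidual p i x) (pillarResidual p j y) =
      inner ℝ x y + (if i = j then -(1 / 9) else 1 / 45 : ℝ) := by
  have h : inner ℝ (pillarResidual p i x) (pillarResidual p j y) = (inner ℝ (pillarResidual p i x) y : ℝ) := by
    conv_lhs => rw [pillarResidual.eq_def p j y]
    simp only [inner_add_right, inner_sub_right, real_inner_smul_right,
      inner_pillarResidual_base hp hx]
    ring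
  have hy' : ∀ k, inner ℝ (p k) y = if k = j then (1 / 5 : ℝ) else -(1 / 5) := fun k => by
    rw [real_inner_comm, hy k]
  rw [h]
  simp only [pillarResidual, inner_add_left, inner_sub_left, real_inner_smul_left, hy']
  fin_cases i <;> fin_cases j <;> norm_num [Fin.ext_iff] <;> ring

open Classical in
theorem inner_pillarResidual_same (hX : IsEquiangular X (1 / 5)) (hK : HasBaseSize X (1 / 5) 3)
    (hp : IsTriangle X p) {i : Fin 3} {x y : EuclideanSpace ℝ (Fin r)} (hxX : SpansLineOf X x)
    (hyX : SpansLineOf X y) (hx : HasPeak p i x) (hy : HasPeak p i y) :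
    inner ℝ (pillarResidual p i x) (pillarResidual p i y) =
      if x = y then (4 / 5 + 4 / 45 : ℝ) else 4 / 45 := by
  rw [inner_pillarResidual hp hx hy, if_pos rfl]
  split_ifs with h
  · rw [← h, hxX.inner_self hX]; norm_num
  · rw [hx.inner_eq hX hK hp hxX hyX hy h]; norm_num

/-- If one pillar has at least four vectors, any other has at most `54`. -/
theorem card_le_of_four_le (hX : IsEquiangular X (1 / 5)) (hK : HasBaseSize X (1 / 5) 3)
    (hp : IsTriangle X p) {i j : Fin 3} (hij : i ≠ j) {S T : Finset (EuclideanSpace ℝ (Fin r))}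
    (hS : ∀ x ∈ S, SpansLineOf X x ∧ HasPeak p i x)
    (hT : ∀ x ∈ T, SpansLineOf X x ∧ HasPeak p j x) (h4 : 4 ≤ S.card) : T.card ≤ 54 := by
  classical
  obtain ⟨S', hS', hc⟩ := Finset.exists_subset_card_eq h4
  let e : Fin 4 ≃ S' := (S'.equivFinOfCardEq hc).symm
  have he : ∀ a, SpansLineOf X (e a : EuclideanSpace ℝ (Fin r)) ∧
      HasPeak p i (e a : EuclideanSpace ℝ (Fin r)) := fun a => hS _ (hS' (e a).2)
  have einj : ∀ a b, (e a : EuclideanSpace ℝ (Fin r)) = e b ↔ a = b := fun a b => by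
    rw [Subtype.coe_inj, e.apply_eq_iff_eq]
  have hval : ∀ a, ∀ t ∈ T, inner ℝ (e a : EuclideanSpace ℝ (Fin r)) t = (-(1 / 5) : ℝ) ∨
      inner ℝ (e a : EuclideanSpace ℝ (Fin r)) t = (1 / 5 : ℝ) := fun a t ht =>
    (he a).2.inner_eq_or hX hij (he a).1 (hT t ht).1 (hT t ht).2
  refine card_le_of_nested (fun a => pillarResidual p i (e a)) (fun a b => ?_) (pillarResidual p j) T
    (fun x hx y hy => by
      convert inner_pillarResidual_same hX hK hp (hT x hx).1 (hT y hy).1 (hT x hx).2 (hT y hy).2)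
    (fun t => Finset.univ.filter fun a => inner ℝ (e a : EuclideanSpace ℝ (Fin r)) t = (1 / 5 : ℝ))
    (fun t ht a => ?_) (fun x hx y hy => ?_)
  · simp only [inner_pillarResidual_same hX hK hp (he a).1 (he b).1 (he a).2 (he b).2, einj]
  · rw [inner_pillarResidual hp (he a).2 (hT t ht).2, if_neg hij]
    simp only [Finset.mem_filter, Finset.mem_univ, true_and]
    rcases hval a t ht with h | h <;> rw [h] <;> norm_num
  · by_contra hcon
    rw [not_or, Finset.not_subset, Finset.not_subset] at hcon
    obtain ⟨⟨a, hax, hay⟩, b, hby, hbx⟩ := hcon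
    simp only [Finset.mem_filter, Finset.mem_univ, true_and] at hax hay hbx hby
    have hay := (hval a y hy).resolve_right hay
    have hbx := (hval b x hx).resolve_right hbx
    have hab : (e a : EuclideanSpace ℝ (Fin r)) ≠ e b := fun h => by
      rw [h, hbx] at hax; norm_num at hax
    have hxy : x ≠ y := fun h => by rw [h, hay] at hax; norm_num at hax
    have h1 := (he a).2.inner_eq hX hK hp (he a).1 (he b).1 (he b).2 hab
    have h2 := (hT x hx).2.inner_eq hX hK hp (hT x hx).1 (hT y hy).1 (hT y hy).2 hxy
    -- If neither pattern contains the other, the vectors a, -b, -x, y have all mutual inner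
    -- products -1/5.
    refine no_four_clique' hX hK (he a).1 (he b).1.neg (hT x hx).1.neg (hT y hy).1
      ?_ ?_ hay ?_ ?_ ?_
    · rw [inner_neg_right, h1]
    · rw [inner_neg_right, hax]
    · rw [inner_neg_neg, hbx]
    · rw [inner_neg_left, hby]
    · rw [inner_neg_left, h2]

/-- A pillar together with the base is linearly independent. -/
theorem card_add_three_le (hX : IsEquiangular X (1 / 5)) (hK : HasBaseSize X (1 / 5) 3)
    (hp : IsTriangle X p) {i : Fin 3} {S : Finset (EuclideanSpace ℝ (Fin r))}
    (hS : ∀ x ∈ S, SpansLineOf X x ∧ HasPeak p i x) : S.card + 3 ≤ r := by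
  classical
  set W := Submodule.span ℝ (Set.range p) with hW
  have hpind : LinearIndependent ℝ p := by
    rw [Fintype.linearIndependent_iff]
    intro c hc
    have h := inner_sum_smul_of_gram Finset.univ p (6 / 5) (-1 / 5)
      (fun x _ y _ => by rw [hp.gram x y]; norm_num) c
    rw [hc, inner_zero_left, Fin.sum_univ_three, Fin.sum_univ_three] at h
    have h0 : c 0 ^ 2 + c 1 ^ 2 + c 2 ^ 2 ≤ 0 := by
      nlinarith [sq_nonneg (c 0 - c 1), sq_nonneg (c 0 - c 2), sq_nonneg (c 1 - c 2)]
    have h1 : c 0 = 0 := by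
      apply pow_eq_zero_iff (two_ne_zero) |>.1
      nlinarith [sq_nonneg (c 0), sq_nonneg (c 1), sq_nonneg (c 2)]
    have h2 : c 1 = 0 := by
      apply pow_eq_zero_iff (two_ne_zero) |>.1
      nlinarith [sq_nonneg (c 0), sq_nonneg (c 1), sq_nonneg (c 2)]
    have h3 : c 2 = 0 := by
      apply pow_eq_zero_iff (two_ne_zero) |>.1
      nlinarith [sq_nonneg (c 0), sq_nonneg (c 1), sq_nonneg (c 2)]
    intro k
    fin_cases k
    exacts [h1, h2, h3]
  have hrank : Module.finrank ℝ W = 3 := by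
    rw [hW, finrank_span_eq_card hpind, Fintype.card_fin]
  have hmem : ∀ x : S, pillarResidual p i x ∈ Wᗮ := by
    intro x
    rw [hW, Submodule.mem_orthogonal']
    intro u hu
    induction hu using Submodule.span_induction with
    | mem u hu =>
      obtain ⟨k, rfl⟩ := hu
      exact inner_pillarResidual_base hp (hS x x.2).2 k
    | zero => exact inner_zero_right _
    | add u v _ _ hu hv => rw [inner_add_right, hu, hv, add_zero]
    | smul c u _ hu => rw [inner_smul_right, hu, mul_zero]
  have hind : LinearIndependent ℝ (fun x : S => (⟨pillarResidual p i x, hmem x⟩ : Wᗮ)) := by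
    rw [Fintype.linearIndependent_iff]
    intro c hc
    have hc' : ∑ x : S, c x • pillarResidual p i x = 0 := by
      have := congrArg (Submodule.subtype Wᗮ) hc
      simpa using this
    have h := inner_sum_smul_of_gram Finset.univ (fun x : S => pillarResidual p i x) (4 / 5) (4 / 45)
      (fun x _ y _ => by
        simp only [inner_pillarResidual_same hX hK hp (hS x x.2).1 (hS y y.2).1 (hS x x.2).2
          (hS y y.2).2, Subtype.coe_inj]
        congr) c
    rw [hc', inner_zero_left] at h
    -- Positive definiteness: both terms of the quadratic form are nonnegative.
    have h0 : ∑ x, c x ^ 2 = 0 := by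
      have h1 : 0 ≤ ∑ x, c x ^ 2 := Finset.sum_nonneg fun x _ => sq_nonneg _
      nlinarith [sq_nonneg (∑ x, c x)]
    intro x
    have := (Finset.sum_eq_zero_iff_of_nonneg fun x _ => sq_nonneg (c x)).1 h0 x
      (Finset.mem_univ x)
    exact pow_eq_zero_iff two_ne_zero |>.1 this
  have h1 := hind.fintype_card_le_finrank
  have h2 := W.finrank_add_finrank_orthogonal
  rw [hrank, finrank_euclideanSpace_fin] at h2
  rw [Fintype.card_coe] at h1
  omega

end Equiangular

/-! ### From the pillar decomposition to the global count -/

section Base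

variable {r : ℕ} {X : Finset (EuclideanSpace ℝ (Fin r))} {p : Fin 3 → EuclideanSpace ℝ (Fin r)}

theorem IsKBase.isTriangle (h : IsKBase X (1 / 5) p) : IsTriangle X p := by
  obtain ⟨-, ⟨Y, ⟨s, hs, rfl⟩, hp⟩, hG⟩ := h
  refine ⟨fun i => ?_, fun i j => ?_⟩
  · obtain ⟨x, hx, hxp⟩ := Finset.mem_image.1 (hp i)
    rw [← hxp]
    rcases hs x with h | h <;> rw [h]
    · rw [one_smul]; exact Or.inl hx
    · rw [neg_one_smul]; exact Or.inr (by rwa [neg_neg])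
  · have := congrFun (congrFun hG i) j
    rw [Matrix.gram_apply] at this
    rw [this, cliqueGram]
    simp only [Matrix.sub_apply, Matrix.smul_apply, Matrix.one_apply, Matrix.of_apply, smul_eq_mul]
    split_ifs <;> norm_num

theorem exists_isTriangle (hK : HasBaseSize X (1 / 5) 3) :
    ∃ p : Fin 3 → EuclideanSpace ℝ (Fin r), IsTriangle X p := by
  obtain ⟨q, hq, b, σ, hb, hG⟩ := hK.1
  refine ⟨fun i => b i • q (σ.symm i), fun i => ?_, fun i j => ?_⟩
  · rcases hb i with h | h <;> simp only [h]
    · rw [one_smul]; exact Or.inl (hq _)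
    · rw [neg_one_smul]; exact Or.inr (by rw [neg_neg]; exact hq _)
  · have := congrFun (congrFun hG i) j
    rw [Matrix.transpose_mul, Matrix.diagonal_transpose, Matrix.mul_assoc, Matrix.mul_assoc,
      Matrix.diagonal_mul, ← Matrix.mul_assoc, ← Matrix.mul_assoc, Matrix.mul_diagonal,
      Matrix.transpose_permMatrix, Matrix.mul_assoc] at this
    simp only [real_inner_smul_left, real_inner_smul_right]
    simp only [Equiv.Perm.permMatrix, PEquiv.toMatrix_toPEquiv_mul, PEquiv.mul_toMatrix_toPEquiv,
      Matrix.submatrix_apply, Matrix.gram_apply, cliqueGram, Matrix.sub_apply, Matrix.smul_apply,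
      Matrix.one_apply, Matrix.of_apply, smul_eq_mul, id] at this
    split_ifs at this ⊢ <;> simp at this ⊢ <;> linarith

theorem normalizeSign_eq_or (x : EuclideanSpace ℝ (Fin r)) :
    normalizeSign (1 / 5) p x = x ∨ normalizeSign (1 / 5) p x = -x := by
  unfold normalizeSign
  split_ifs
  · exact Or.inr rfl
  · exact Or.inl rfl

theorem SpansLineOf.of_eq_or_neg {x y : EuclideanSpace ℝ (Fin r)} (hx : x ∈ X)
    (h : y = x ∨ y = -x) : SpansLineOf X y := by
  rcases h with rfl | rfl
  · exact Or.inl hx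
  · exact Or.inr (by rwa [neg_neg])

theorem inner_base_of_mem_outsideBase (hX : IsEquiangular X (1 / 5)) (hp : IsTriangle X p)
    {x : EuclideanSpace ℝ (Fin r)} (hx : x ∈ outsideBase X (1 / 5) p) (i : Fin 3) :
    SpansLineOf X x ∧
      (inner ℝ x (p i) = (-(1 / 5) : ℝ) ∨ inner ℝ x (p i) = (1 / 5 : ℝ)) := by
  obtain ⟨y, hy, rfl⟩ := Finset.mem_image.1 hx
  obtain ⟨hyX, hyp⟩ := Finset.mem_filter.1 hy
  have hs := SpansLineOf.of_eq_or_neg hyX (normalizeSign_eq_or (p := p) y)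
  refine ⟨hs, hs.inner_eq hX (hp.spans i) ?_ ?_⟩
  · rcases normalizeSign_eq_or (p := p) y with h | h <;> rw [h]
    · exact (hyp i).1
    · exact fun h' => (hyp i).2 (by rw [← h', neg_neg])
  · rcases normalizeSign_eq_or (p := p) y with h | h <;> rw [h]
    · exact (hyp i).2
    · exact fun h' => (hyp i).1 (neg_injective h')

theorem posCount_epsVec_neg {x : EuclideanSpace ℝ (Fin r)}
    (hx : ∀ i, inner ℝ x (p i) = (-(1 / 5) : ℝ) ∨ inner ℝ x (p i) = (1 / 5 : ℝ)) :
    posCount (epsVec (1 / 5) p x) + posCount (epsVec (1 / 5) p (-x)) = 3 := by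
  classical
  have h : (Finset.univ.filter fun i => 0 < epsVec (1 / 5) p (-x) i) =
      Finset.univ.filter fun i => ¬ 0 < epsVec (1 / 5) p x i := by
    refine Finset.filter_congr fun i _ => ?_
    rw [epsVec, epsVec, inner_neg_left]
    rcases hx i with h | h <;> rw [h] <;> norm_num
  have h3 := Finset.card_filter_add_card_filter_not (s := (Finset.univ : Finset (Fin 3)))
    (fun i => 0 < epsVec (1 / 5) p x i)
  unfold posCount
  convert h3 using 2
  · convert congrArg Finset.card h
  · simp

theorem hasPeak_of_posCount_eq_one (hX : IsEquiangular X (1 / 5)) (hp : IsTriangle X p)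
    {x : EuclideanSpace ℝ (Fin r)} (hx : x ∈ outsideBase X (1 / 5) p)
    (h1 : posCount (epsVec (1 / 5) p x) = 1) : ∃ i, HasPeak p i x := by
  obtain ⟨i, hi⟩ := Finset.card_eq_one.1 h1
  refine ⟨i, fun j => ?_⟩
  have hj : 0 < epsVec (1 / 5) p x j ↔ j = i := by
    have := Finset.ext_iff.1 hi j
    simpa using this
  rw [epsVec] at hj
  rcases (inner_base_of_mem_outsideBase hX hp hx j).2 with h | h <;> rw [h] at hj ⊢
  · rw [if_neg fun h' => by have := hj.2 h'; norm_num at this]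
  · rw [if_pos (hj.1 (by norm_num))]

/-- Every vector outside the base lies in a `(3, 1)` pillar. -/
theorem posCount_eq_one (hX : IsEquiangular X (1 / 5)) (hK : HasBaseSize X (1 / 5) 3)
    (hp : IsTriangle X p) {x : EuclideanSpace ℝ (Fin r)} (hx : x ∈ outsideBase X (1 / 5) p) :
    posCount (epsVec (1 / 5) p x) = 1 := by
  have hle : posCount (epsVec (1 / 5) p x) ≤ posCount (epsVec (1 / 5) p (-x)) := by
    obtain ⟨y, hy, rfl⟩ := Finset.mem_image.1 hx
    unfold normalizeSign
    split_ifs with h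
    · rw [neg_neg]
      rcases h with h | h
      · exact h.le
      · exact h.1.le
    · exact not_lt.1 fun h' => h (Or.inl h')
  have hsum := posCount_epsVec_neg fun i => (inner_base_of_mem_outsideBase hX hp hx i).2
  have h0 : posCount (epsVec (1 / 5) p x) ≠ 0 := by
    intro h0
    have hneg : ∀ i, inner ℝ x (p i) = (-(1 / 5) : ℝ) := by
      intro i
      refine (inner_base_of_mem_outsideBase hX hp hx i).2.resolve_right fun h => ?_
      have := Finset.filter_eq_empty_iff.1 (Finset.card_eq_zero.1 h0) (Finset.mem_univ i)
      rw [epsVec, h] at this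
      norm_num at this
    exact no_four_clique' hX hK (inner_base_of_mem_outsideBase hX hp hx 0).1 (hp.spans 0)
      (hp.spans 1) (hp.spans 2) (hneg 0) (hneg 1) (hneg 2)
      (by rw [hp.gram, if_neg (by decide)]) (by rw [hp.gram, if_neg (by decide)])
      (by rw [hp.gram, if_neg (by decide)])
  omega

/-- X contains no antipodal pair, so the sign choice is injective and each base line accounts for at
most one removed vector. -/
theorem card_le_card_outsideBase (hX : IsEquiangular X (1 / 5)) :
    X.card ≤ (outsideBase X (1 / 5) p).card + 3 := by
  classical
  have hinj : Set.InjOn (normalizeSign (1 / 5) p)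
      (X.filter (fun x => ∀ i, x ≠ p i ∧ x ≠ -p i) : Finset (EuclideanSpace ℝ (Fin r))) := by
    intro x hx y hy hxy
    have hxX := (Finset.mem_filter.1 hx).1
    have hyX := (Finset.mem_filter.1 hy).1
    rcases normalizeSign_eq_or (p := p) x with h | h <;>
      rcases normalizeSign_eq_or (p := p) y with h' | h' <;> rw [h, h'] at hxy
    · exact hxy
    · exact absurd (hxy ▸ hxX) (not_neg_mem hX hyX)
    · exact absurd (hxy ▸ hyX) (not_neg_mem hX hxX)
    · exact neg_injective hxy
  have h1 : (outsideBase X (1 / 5) p).card =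
      (X.filter (fun x => ∀ i, x ≠ p i ∧ x ≠ -p i)).card := by
    unfold outsideBase
    convert Finset.card_image_of_injOn hinj
  have h2 : (X.filter (fun x => ¬ ∀ i, x ≠ p i ∧ x ≠ -p i)).card ≤ 3 := by
    have hex : ∀ x : X.filter (fun x => ¬ ∀ i, x ≠ p i ∧ x ≠ -p i),
        ∃ i, (x : EuclideanSpace ℝ (Fin r)) = p i ∨ (x : EuclideanSpace ℝ (Fin r)) = -p i := by
      intro x
      have := (Finset.mem_filter.1 x.2).2
      push Not at this
      obtain ⟨i, hi⟩ := this
      exact ⟨i, or_iff_not_imp_left.2 hi⟩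
    choose c hc using hex
    have hcinj : Function.Injective c := by
      intro x y hxy
      have hxX := (Finset.mem_filter.1 x.2).1
      have hyX := (Finset.mem_filter.1 y.2).1
      have hx := hc x
      have hy := hc y
      rw [← hxy] at hy
      rcases hx with hx | hx <;> rcases hy with hy | hy
      · exact Subtype.ext (hx.trans hy.symm)
      · rw [← hx] at hy; exact absurd (hy ▸ hyX) (not_neg_mem hX hxX)
      · rw [← hy] at hx; exact absurd (hx ▸ hxX) (not_neg_mem hX hyX)
      · exact Subtype.ext (hx.trans hy.symm)
    have := Fintype.card_le_of_injective c hcinj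
    rwa [Fintype.card_coe, Fintype.card_fin] at this
  have h3 := Finset.card_filter_add_card_filter_not (s := X) (fun x => ∀ i, x ≠ p i ∧ x ≠ -p i)
  omega

/-- The pillar bound in terms of `pillar`. -/
theorem pillar_card_le (hX : IsEquiangular X (1 / 5)) (hK : HasBaseSize X (1 / 5) 3)
    (hp : IsTriangle X p) {S T : Finset (EuclideanSpace ℝ (Fin r))}
    (hS : IsPillar X (1 / 5) p 1 S) (hT : IsPillar X (1 / 5) p 1 T) (hne : S ≠ T)
    (h4 : 4 ≤ S.card) : T.card ≤ 54 := by
  obtain ⟨x, hx, hx1, rfl⟩ := hS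
  obtain ⟨y, hy, hy1, rfl⟩ := hT
  obtain ⟨i, hi⟩ := hasPeak_of_posCount_eq_one hX hp hx hx1
  obtain ⟨j, hj⟩ := hasPeak_of_posCount_eq_one hX hp hy hy1
  have hmem : ∀ {k z}, HasPeak p k z → ∀ w ∈ pillar X (1 / 5) p z,
      SpansLineOf X w ∧ HasPeak p k w := by
    intro k z hz w hw
    obtain ⟨hwO, hwe⟩ := Finset.mem_filter.1 hw
    refine ⟨(inner_base_of_mem_outsideBase hX hp hwO 0).1, fun l => ?_⟩
    rw [← hz l]
    have := congrFun hwe l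
    simp only [epsVec] at this
    linarith
  have hij : i ≠ j := by
    rintro rfl
    apply hne
    have : epsVec (1 / 5) p x = epsVec (1 / 5) p y := by
      funext l
      rw [epsVec, epsVec, hi l, hj l]
    rw [pillar, pillar, this]
  exact card_le_of_four_le hX hK hp hij (hmem hi) (hmem hj) h4

theorem card_le_max (hX : IsEquiangular X (1 / 5)) (hK : HasBaseSize X (1 / 5) 3) :
    X.card ≤ max 165 (r + 6) := by
  classical
  obtain ⟨p, hp⟩ := exists_isTriangle hK
  set O := outsideBase X (1 / 5) p with hO
  set Q : Fin 3 → Finset (EuclideanSpace ℝ (Fin r)) := fun i => O.filter (HasPeak p i) with hQ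
  have hQm : ∀ i, ∀ x ∈ Q i, SpansLineOf X x ∧ HasPeak p i x := by
    intro i x hx
    obtain ⟨hxO, hxi⟩ := Finset.mem_filter.1 hx
    exact ⟨(inner_base_of_mem_outsideBase hX hp hxO 0).1, hxi⟩
  have hcov : O ⊆ Finset.univ.biUnion Q := by
    intro x hx
    obtain ⟨i, hi⟩ := hasPeak_of_posCount_eq_one hX hp hx (posCount_eq_one hX hK hp hx)
    exact Finset.mem_biUnion.2 ⟨i, Finset.mem_univ i, Finset.mem_filter.2 ⟨hx, hi⟩⟩
  have h1 : O.card ≤ (Q 0).card + (Q 1).card + (Q 2).card := by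
    have := (Finset.card_le_card hcov).trans Finset.card_biUnion_le
    rwa [Fin.sum_univ_three] at this
  have h2 : X.card ≤ O.card + 3 := card_le_card_outsideBase hX
  have hr : ∀ i, (Q i).card + 3 ≤ r := fun i => card_add_three_le hX hK hp (hQm i)
  have hb : ∀ i j, i ≠ j → 4 ≤ (Q i).card → (Q j).card ≤ 54 := fun i j hij =>
    card_le_of_four_le hX hK hp hij (hQm i) (hQm j)
  have := hr 0
  have := hr 1
  have := hr 2
  have := hb 0 1 (by decide)
  have := hb 0 2 (by decide)
  have := hb 1 0 (by decide)
  have := hb 1 2 (by decide)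
  have := hb 2 0 (by decide)
  have := hb 2 1 (by decide)
  -- Two pillars of size at least 4 force 3·54 + 3 = 165; exactly one gives (r - 3) + 3 + 3 + 3 = r
  -- + 6; none gives at most 12.
  omega

end Base

theorem mainTheorem2 (r : ℕ) (X : Finset (EuclideanSpace ℝ (Fin r)))
    (hX : IsEquiangular X (1 / 5)) (hK : HasBaseSize X (1 / 5) 3) :
    (∀ p : Fin 3 → EuclideanSpace ℝ (Fin r), IsKBase X (1 / 5) p →
      ∀ S T : Finset (EuclideanSpace ℝ (Fin r)),
        IsPillar X (1 / 5) p 1 S → IsPillar X (1 / 5) p 1 T → S ≠ T →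
          4 ≤ S.card → T.card ≤ 54) ∧
    X.card ≤ max 165 (r + 6) ∧
    (23 ≤ r → r ≤ 185 → X.card < 276) ∧
    (185 ≤ r → X.card < (r - 5) / 2 + r + 1) := by
  have h := card_le_max hX hK
  refine ⟨fun p hp S T hS hT hne h4 => pillar_card_le hX hK hp.isTriangle hS hT hne h4, h, ?_, ?_⟩
  -- Here max(165, r + 6) ≤ 191.
  · intro _ _
    omega
  -- Here the maximum is r + 6, while the floor (r - 5) / 2 is at least 90.
  · intro _
    omega
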